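/- Let $\mathbf B_3=\langle\sigma_1,\sigma_2\mid\sigma_1\sigma_2\sigma_1=\sigma_2\sigma_1\sigma_2\rangle$ be the group of braids with three strings. A quasipositive factorization of $X\in\mathbf B_3$ is a tuple $(X_1,\dots,X_k)\in\mathbf B_3^k$, $k\ge 0$, such that $X_1\cdots X_k=X$ and each $X_i$ is conjugate in $\mathbf B_3$ to $\sigma_1$. The Hurwitz action is the action of the braid group $\mathbf B_k$ on $\mathbf B_3^k$ in which the $i$-th standard generator ($1\le i<k$) replaces $(X_i,X_{i+1})$ by $(X_iX_{i+1}X_i^{-1},X_i)$ and fixes the other entries; two factorizations are Hurwitz equivalent if they have the same length $k$ and lie in the same orbit of this action. Let $X\in\mathbf B_3$ be positive, that is, represented by a (possibly empty) word in $\sigma_1,\sigma_2$ (without inverses). Then any two quasipositive factorizations of $X$ are Hurwitz equivalent; in particular, they have the same length. -/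

import Mathlib

namespace HurwitzBraid

/-- The defining relators of the braid group on `n` strings, on the generators
`s 0, …, s (n - 2)`: the braid relations for adjacent generators, and the commutation
relations for generators that are at distance at least two. -/
def braidRels (n : ℕ) : Set (FreeGroup (Fin (n - 1))) :=
  {r | ∃ i j : Fin (n - 1), (i : ℕ) + 1 = (j : ℕ) ∧
      r = (FreeGroup.of i * FreeGroup.of j * FreeGroup.of i) *
        (FreeGroup.of j * FreeGroup.of i * FreeGroup.of j)⁻¹} ∪
  {r | ∃ i j : Fin (n - 1), (i : ℕ) + 2 ≤ (j : ℕ) ∧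
      r = (FreeGroup.of i * FreeGroup.of j) * (FreeGroup.of j * FreeGroup.of i)⁻¹}

/-- The braid group on `n` strings (trivial for `n = 0` and `n = 1`). -/
abbrev BraidGroup (n : ℕ) : Type := PresentedGroup (braidRels n)

/-- The group of braids with three strings,
`⟨σ₁, σ₂ ∣ σ₁ σ₂ σ₁ = σ₂ σ₁ σ₂⟩`; the generators are indexed by `0` and `1`. -/
abbrev B3 : Type :=
  PresentedGroup
    ({(FreeGroup.of 0 * FreeGroup.of 1 * FreeGroup.of 0) *
      (FreeGroup.of 1 * FreeGroup.of 0 * FreeGroup.of 1)⁻¹} : Set (FreeGroup (Fin 2)))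

/-- The standard generator `σ₁`. -/
def σ₁ : B3 := PresentedGroup.of 0

/-- The standard generator `σ₂`. -/
def σ₂ : B3 := PresentedGroup.of 1

/-- A 3-braid is positive if it is represented by a (possibly empty) word over the
alphabet `{σ₁, σ₂}`. -/
def IsPositive (X : B3) : Prop :=
  ∃ w : List B3, (∀ a ∈ w, a = σ₁ ∨ a = σ₂) ∧ w.prod = X

/-- `(x 0, …, x (k - 1))` is a quasipositive factorization of `X`: its ordered product
is `X`, and each factor is conjugate to `σ₁`. -/
def IsQuasipositiveFactorization (X : B3) {k : ℕ} (x : Fin k → B3) : Prop :=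
  (List.ofFn x).prod = X ∧ ∀ i, IsConj σ₁ (x i)

section Hurwitz

variable {G : Type*} [Group G] {k : ℕ}

/-- The Hurwitz move at positions `i, i + 1`, which replaces `(xᵢ, xᵢ₊₁)` by
`(xᵢ xᵢ₊₁ xᵢ⁻¹, xᵢ)`, as a permutation of `G ^ k`. -/
def hurwitzMove (i : Fin (k - 1)) : Equiv.Perm (Fin k → G) where
  toFun x j :=
    if (j : ℕ) = i then
      x ⟨i, by omega⟩ * x ⟨i + 1, by omega⟩ * (x ⟨i, by omega⟩)⁻¹
    else if (j : ℕ) = i + 1 then x ⟨i, by omega⟩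
    else x j
  invFun y j :=
    if (j : ℕ) = i then y ⟨i + 1, by omega⟩
    else if (j : ℕ) = i + 1 then
      (y ⟨i + 1, by omega⟩)⁻¹ * y ⟨i, by omega⟩ * y ⟨i + 1, by omega⟩
    else y j
  left_inv x := by
    funext ⟨j, hj⟩
    by_cases h1 : j = i
    · subst h1; simp
    · by_cases h2 : j = i + 1
      · subst h2; simp [mul_assoc]
      · simp [h1, h2]
  right_inv y := by
    funext ⟨j, hj⟩
    by_cases h1 : j = i
    · subst h1; simp [mul_assoc]
    · by_cases h2 : j = i + 1
      · subst h2; simp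
      · simp [h1, h2]

theorem hurwitzMove_apply (i : Fin (k - 1)) (x : Fin k → G) (j : Fin k) :
    hurwitzMove i x j =
      if (j : ℕ) = i then
        x ⟨i, by omega⟩ * x ⟨i + 1, by omega⟩ * (x ⟨i, by omega⟩)⁻¹
      else if (j : ℕ) = i + 1 then x ⟨i, by omega⟩
      else x j := rfl

set_option linter.unusedSimpArgs false in
theorem hurwitzMove_rels (r : FreeGroup (Fin (k - 1))) (hr : r ∈ braidRels k) :
    FreeGroup.lift (fun i => (hurwitzMove i : Equiv.Perm (Fin k → G))) r = 1 := by
  rcases hr with ⟨⟨i, hi⟩, ⟨j, hj⟩, hij, rfl⟩ | ⟨⟨i, hi⟩, ⟨j, hj⟩, hij, rfl⟩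
  · simp only [map_mul, map_inv, FreeGroup.lift_apply_of, mul_inv_eq_one]
    simp only at hij
    subst hij
    ext x ⟨l, hl⟩
    simp only [Equiv.Perm.mul_apply, hurwitzMove_apply]
    have e1 : i + 1 + 1 ≠ i := by omega
    have e2 : i ≠ i + 1 + 1 := by omega
    by_cases h1 : l = i
    · subst h1; simp [e1, e2, mul_assoc]
    · by_cases h2 : l = i + 1
      · subst h2; simp [e1, e2]
      · by_cases h3 : l = i + 1 + 1
        · subst h3; simp [e1, e2]
        · simp [h1, h2, h3]
  · simp only [map_mul, map_inv, FreeGroup.lift_apply_of, mul_inv_eq_one]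
    simp only at hij
    ext x ⟨l, hl⟩
    simp only [Equiv.Perm.mul_apply, hurwitzMove_apply]
    have e1 : i ≠ j := by omega
    have e2 : i ≠ j + 1 := by omega
    have e3 : i + 1 ≠ j := by omega
    have e4 : i + 1 ≠ j + 1 := by omega
    by_cases h1 : l = i
    · subst h1; simp [e1, e1.symm, e2, e2.symm, e3, e3.symm]
    · by_cases h2 : l = i + 1
      · subst h2; simp [e1, e1.symm, e2, e2.symm, e3, e3.symm]
      · by_cases h3 : l = j
        · subst h3; simp [e1, e1.symm, e2, e2.symm, e3, e3.symm]
        · by_cases h4 : l = j + 1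
          · subst h4; simp [e1, e1.symm, e2, e2.symm, e3, e3.symm]
          · simp [h1, h2, h3, h4]

/-- The Hurwitz action of the braid group on `k` strings on `G ^ k`; the `i`-th standard
generator acts by the `i`-th Hurwitz move. -/
def hurwitzAction (G : Type*) [Group G] (k : ℕ) : BraidGroup k →* Equiv.Perm (Fin k → G) :=
  PresentedGroup.toGroup (f := fun i => hurwitzMove i) hurwitzMove_rels

/-- Two tuples are Hurwitz equivalent if they have the same length and belong to the same
orbit of the Hurwitz action. -/
def HurwitzEquivalent {k l : ℕ} (x : Fin k → G) (y : Fin l → G) : Prop :=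
  ∃ h : k = l, ∃ b : BraidGroup k, hurwitzAction G k b x = y ∘ Fin.cast h

end Hurwitz

end HurwitzBraid

namespace HurwitzBraid

/-! The proof uses the dual Garside structure: three atoms, indexed cyclically, with `atom i * atom
(i + 1) = delta`, and conjugation by `delta` shifts the index. Reduced words represent the cosets of
the powers of `delta`; they are the vertices of a trivalent tree, on which the group acts by
isometries (`lcp_act`). Let `len g` be the displacement of the root.

A positive `X` of exponent sum `k` has `len X ≤ k`, and `k` is also the length of every
quasipositive factorization. If less than half of each factor cancels between neighbours,
`separated_chain` makes the product longer than `k` unless all factors are atoms. Otherwise some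
neighbours cancel more (`reduce_pair`): either a Hurwitz move shortens one of them, or they are two
atoms with product `delta`. In the latter case the pair can be carried along the tuple and used to
shorten a factor that is not an atom (`reduce_delta`). Descent on the total length thus reaches a
tuple of atoms (`exists_hurwitzRel_atoms`).

For atoms, Hurwitz moves collect the pairs with product `delta` on the left until the rest is a
reduced word. The product determines this form (`hurwitzRel_of_atoms`). -/

/-! ### Dual generators of the braid group -/

/-- The Birman–Ko–Lee generators of `B3`. -/
def atom (i : ZMod 3) : B3 :=
  if i = 0 then σ₁ else if i = 1 then σ₂ else σ₁ * σ₂ * σ₁⁻¹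

/-- The product of the two standard generators, the Garside element of the dual structure. -/
def delta : B3 := σ₁ * σ₂

theorem braid_relation : σ₁ * σ₂ * σ₁ = σ₂ * σ₁ * σ₂ :=
  mul_inv_eq_one.1 (PresentedGroup.one_of_mem (Set.mem_singleton _))

theorem atom_mul_atom (i : ZMod 3) : atom i * atom (i + 1) = delta := by
  have h := braid_relation
  have h0 : atom 0 = σ₁ := rfl
  have h1 : atom 1 = σ₂ := rfl
  have h2 : atom 2 = σ₁ * σ₂ * σ₁⁻¹ := rfl
  have h10 : (1 : ZMod 3) + 1 = 2 := rfl
  have h20 : (2 : ZMod 3) + 1 = 0 := rfl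
  obtain rfl | rfl | rfl : i = 0 ∨ i = 1 ∨ i = 2 := by decide +revert
  · rw [zero_add]; rfl
  · rw [h10, h1, h2, delta, ← mul_assoc, ← mul_assoc, ← h]; group
  · rw [h20, h0, h2, delta]; group

theorem add_two_add_one (i : ZMod 3) : i + 2 + 1 = i := by decide +revert

theorem delta_mul_atom (i : ZMod 3) : delta * atom i = atom (i + 1) * delta := by
  have h1 := atom_mul_atom (i + 1)
  have h2 := atom_mul_atom (i + 2)
  rw [add_two_add_one] at h2
  rw [show i + 1 + 1 = i + 2 by ring] at h1
  rw [← h1, mul_assoc, h2, h1]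

theorem atom_inv (i : ZMod 3) : (atom i)⁻¹ = atom (i + 1) * delta⁻¹ := by
  rw [← atom_mul_atom i]; group

/-- The braid represented by a word in the Birman–Ko–Lee generators. -/
def word (α : List (ZMod 3)) : B3 := (α.map atom).prod

theorem word_nil : word [] = 1 := rfl

theorem word_cons (i : ZMod 3) (α : List (ZMod 3)) : word (i :: α) = atom i * word α := by
  simp [word]

theorem word_append (α β : List (ZMod 3)) : word (α ++ β) = word α * word β := by
  simp [word]

theorem delta_mul_word (α : List (ZMod 3)) :
    delta * word α = word (α.map (· + 1)) * delta := by
  induction α with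
  | nil => simp [word_nil]
  | cons i α ih =>
    rw [List.map_cons, word_cons, word_cons, mul_assoc (atom _), ← ih, ← mul_assoc delta,
      delta_mul_atom, mul_assoc (atom _)]

theorem induction_left {p : B3 → Prop} (one : p 1)
    (mul : ∀ i g, p g → p (atom i * g)) (inv_mul : ∀ i g, p g → p ((atom i)⁻¹ * g)) (g : B3) :
    p g := by
  have hg : g ∈ Subgroup.closure (Set.range (PresentedGroup.of (rels :=
      ({(FreeGroup.of 0 * FreeGroup.of 1 * FreeGroup.of 0) *
      (FreeGroup.of 1 * FreeGroup.of 0 * FreeGroup.of 1)⁻¹} : Set (FreeGroup (Fin 2)))))) := by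
    rw [PresentedGroup.closure_range_of]; trivial
  have key : ∀ j : Fin 2, ∃ i, PresentedGroup.of j = atom i := fun j => by
    fin_cases j
    exacts [⟨0, rfl⟩, ⟨1, rfl⟩]
  induction hg using Subgroup.closure_induction_left with
  | one => exact one
  | mul_left x hx y hy ih =>
    obtain ⟨j, rfl⟩ := hx
    obtain ⟨i, hi⟩ := key j
    exact hi ▸ mul i y ih
  | inv_mul_cancel x hx y hy ih =>
    obtain ⟨j, rfl⟩ := hx
    obtain ⟨i, hi⟩ := key j
    exact hi ▸ inv_mul i y ih

/-! ### The action on reduced words -/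

/-- A word is reduced if it contains no subword with product `delta`. -/
def Reduced (α : List (ZMod 3)) : Prop := α.IsChain fun a b => b ≠ a + 1

/-- Reduced words: the vertices of the trivalent tree on which `B3` acts. -/
abbrev RedWord : Type := {α : List (ZMod 3) // Reduced α}

theorem Reduced.map_add {α : List (ZMod 3)} (h : Reduced α) (t : ZMod 3) :
    Reduced (α.map (· + t)) := by
  refine (List.isChain_map _).2 (h.imp fun a b hab h' => hab ?_)
  linear_combination h'

/-- Left multiplication of a reduced word by a generator, modulo right multiplication
by powers of `delta`. -/
def push (i : ZMod 3) : List (ZMod 3) → List (ZMod 3)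
  | [] => [i]
  | b :: w => if b = i + 1 then w.map (· + 1) else i :: b :: w

theorem Reduced.push {w : List (ZMod 3)} (h : Reduced w) (i : ZMod 3) : Reduced (push i w) := by
  cases w with
  | nil => exact List.isChain_singleton _
  | cons b w =>
    simp only [HurwitzBraid.push]
    split_ifs with hb
    · exact Reduced.map_add (List.IsChain.tail h) 1
    · exact List.isChain_cons_cons.2 ⟨hb, h⟩

theorem push_of_head {i : ZMod 3} {w : List (ZMod 3)} (h : ∀ b ∈ w.head?, b ≠ i + 1) :
    push i w = i :: w := by
  cases w with
  | nil => rfl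
  | cons b w => simp only [push]; rw [if_neg (h b rfl)]

theorem push_cons_succ (i : ZMod 3) (w : List (ZMod 3)) :
    push i ((i + 1) :: w) = w.map (· + 1) := by simp [push]

theorem Reduced.head_ne {b : ZMod 3} {w : List (ZMod 3)} (h : Reduced (b :: w)) :
    ∀ c ∈ w.head?, c ≠ b + 1 := (List.isChain_cons.1 h).1

theorem Reduced.tail {b : ZMod 3} {w : List (ZMod 3)} (h : Reduced (b :: w)) : Reduced w :=
  (List.isChain_cons.1 h).2

/-- This is the relation `atom i * atom (i + 1) = delta` on cosets: moving `delta` to the right end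
of a word shifts all its letters, and there it is absorbed. -/
theorem push_push {w : List (ZMod 3)} (h : Reduced w) (i : ZMod 3) :
    push i (push (i + 1) w) = w.map (· + 1) := by
  by_cases hw : ∀ b ∈ w.head?, b ≠ i + 1 + 1
  · rw [push_of_head hw, push_cons_succ]
  · push Not at hw
    obtain ⟨b, hb, rfl⟩ := hw
    obtain ⟨w, rfl⟩ : ∃ w', w = (i + 1 + 1) :: w' := by
      cases w with
      | nil => simp at hb
      | cons c w => simp at hb; exact ⟨w, by rw [hb]⟩
    rw [push_cons_succ, push_of_head, List.map_cons]
    · congr 1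
      generalize i = i
      decide +revert
    · intro b hb hb'
      rw [List.head?_map, Option.mem_def, Option.map_eq_some_iff] at hb
      obtain ⟨c, hc, rfl⟩ := hb
      refine h.head_ne c hc ?_
      have : c = i := add_right_cancel hb'
      rw [this]
      generalize i = i
      decide +revert

theorem map_push (i t : ZMod 3) (w : List (ZMod 3)) :
    (push i w).map (· + t) = push (i + t) (w.map (· + t)) := by
  cases w with
  | nil => rfl
  | cons b w =>
    have : b + t = i + t + 1 ↔ b = i + 1 := by
      constructor <;> intro h <;> linear_combination h
    simp only [push, List.map_cons, this]
    split_ifs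
    · simp only [List.map_map]; congr 1; funext x; simp; ring
    · simp

theorem map_map_add (s t : ZMod 3) (h : s + t = 0) (w : List (ZMod 3)) :
    (w.map (· + s)).map (· + t) = w := by
  rw [List.map_map]
  convert List.map_id w
  funext x
  simp [add_assoc, h]

/-- The action of a generator on reduced words. -/
def pushPerm (i : ZMod 3) : Equiv.Perm RedWord where
  toFun w := ⟨push i w.1, w.2.push i⟩
  -- The inverse follows `atom_inv`; `delta⁻¹` shifts indices by `-1 = 2`.
  invFun w := ⟨push (i + 1) (w.1.map (· + 2)), (w.2.map_add 2).push _⟩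
  left_inv w := by
    apply Subtype.ext
    have h1 : i + 1 = (i + 2) + 2 := by decide +revert
    have h2 := push_push w.2 (i + 2)
    rw [add_two_add_one] at h2
    simp only
    rw [h1, ← map_push, h2, map_map_add]
    rfl
  right_inv w := by
    apply Subtype.ext
    simp only
    rw [push_push (w.2.map_add 2), map_map_add]
    rfl

theorem coe_pushPerm (i : ZMod 3) (w : RedWord) : (pushPerm i w).1 = push i w.1 := rfl

theorem pushPerm_mul_apply (i : ZMod 3) (w : RedWord) :
    (pushPerm i (pushPerm (i + 1) w)).1 = w.1.map (· + 1) := push_push w.2 i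

/-- The action of `B3` on reduced words. -/
def act : B3 →* Equiv.Perm RedWord :=
  PresentedGroup.toGroup (f := fun j : Fin 2 => pushPerm (if j = 0 then 0 else 1)) <| by
    rintro r rfl
    simp only [map_mul, map_inv, FreeGroup.lift_apply_of, mul_inv_eq_one]
    ext1 w
    apply Subtype.ext
    have h1 := pushPerm_mul_apply 0 (pushPerm 0 w)
    have h2 := pushPerm_mul_apply 0 w
    rw [zero_add] at h1 h2
    simp only [Equiv.Perm.mul_apply, one_ne_zero, if_true, if_false]
    rw [h1, coe_pushPerm 1, h2, coe_pushPerm, map_push, zero_add]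

theorem act_atom (i : ZMod 3) (w : RedWord) : (act (atom i) w).1 = push i w.1 := by
  have h0 : act (atom 0) = pushPerm 0 := PresentedGroup.toGroup.of _
  have h1 : act (atom 1) = pushPerm 1 := PresentedGroup.toGroup.of _
  have h2 : act (atom 2) = pushPerm 2 := by
    have : atom 2 = atom 0 * atom 1 * (atom 0)⁻¹ := rfl
    rw [this, map_mul, map_mul, map_inv, h0, h1, mul_inv_eq_iff_eq_mul]
    ext1 w
    apply Subtype.ext
    exact (pushPerm_mul_apply 0 w).trans (pushPerm_mul_apply 2 w).symm
  obtain rfl | rfl | rfl : i = 0 ∨ i = 1 ∨ i = 2 := by decide +revert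
  · rw [h0]; rfl
  · rw [h1]; rfl
  · rw [h2]; rfl

theorem act_delta (w : RedWord) : (act delta w).1 = w.1.map (· + 1) := by
  rw [← atom_mul_atom 0, map_mul, Equiv.Perm.mul_apply, act_atom, act_atom, push_push w.2]

theorem act_atom_inv {i : ZMod 3} {w : RedWord} (h : ∀ b ∈ w.1.head?, b ≠ i) :
    (act (atom i)⁻¹ w).1 = (i + 1) :: w.1.map (· + 2) := by
  have hr : Reduced ((i + 1) :: w.1.map (· + 2)) := by
    refine List.isChain_cons.2 ⟨fun b hb hb' => ?_, w.2.map_add 2⟩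
    rw [List.head?_map, Option.mem_def, Option.map_eq_some_iff] at hb
    obtain ⟨c, hc, rfl⟩ := hb
    exact h c hc (by linear_combination hb')
  have : act (atom i)⁻¹ w = ⟨_, hr⟩ := by
    rw [map_inv, Equiv.Perm.inv_eq_iff_eq]
    apply Subtype.ext
    rw [act_atom, push_cons_succ, map_map_add]
    rfl
  rw [this]

/-! ### Tree distance and displacement length -/

/-- The length of the longest common prefix of two words. -/
def lcp : List (ZMod 3) → List (ZMod 3) → ℕ
  | a :: u, b :: v => if a = b then lcp u v + 1 else 0
  | [], _ => 0
  | _ :: _, [] => 0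

theorem lcp_nil_right (u : List (ZMod 3)) : lcp u [] = 0 := by cases u <;> rfl

theorem lcp_map (t : ZMod 3) (u v : List (ZMod 3)) :
    lcp (u.map (· + t)) (v.map (· + t)) = lcp u v := by
  induction u generalizing v with
  | nil => rfl
  | cons a u ih =>
    cases v with
    | nil => rfl
    | cons b v => simp [lcp, ih]

theorem lcp_self (u : List (ZMod 3)) : lcp u u = u.length := by
  induction u with
  | nil => rfl
  | cons a u ih => simp [lcp, ih]

theorem lcp_comm (u v : List (ZMod 3)) : lcp u v = lcp v u := by
  induction u generalizing v with
  | nil => rw [lcp_nil_right]; rfl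
  | cons a u ih =>
    cases v with
    | nil => rfl
    | cons b v => simp [lcp, ih v, eq_comm]

theorem lcp_ultrametric (u v w : List (ZMod 3)) : min (lcp u v) (lcp v w) ≤ lcp u w := by
  induction u generalizing v w with
  | nil => simp [lcp]
  | cons a u ih =>
    cases v with
    | nil => simp [lcp]
    | cons b v =>
      cases w with
      | nil => simp [lcp]
      | cons c w =>
        have := ih v w
        simp only [lcp]
        split_ifs <;> first | omega | simp_all

theorem prefix_of_le_lcp {u v : List (ZMod 3)} {n : ℕ} (h : n ≤ lcp u v) :
    u.take n = v.take n ∧ n ≤ u.length ∧ n ≤ v.length := by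
  induction u generalizing v n with
  | nil => simp [lcp] at h; simp [h]
  | cons a u ih =>
    cases v with
    | nil => simp [lcp] at h; simp [h]
    | cons b v =>
      cases n with
      | zero => simp
      | succ n =>
        simp only [lcp] at h
        split_ifs at h with hab
        · obtain ⟨h1, h2, h3⟩ := ih (v := v) (n := n) (by omega)
          simp [hab, h1, h2, h3]
        · omega

/-- The tree distance is `|u| + |v| - 2 * lcp u v`, so this is invariance of distance. When only one
of the two words cancels, there is no common prefix before or after the push, and the two length
changes compensate. -/
theorem lcp_push {i : ZMod 3} {u v : List (ZMod 3)} (hu : Reduced u) (hv : Reduced v) :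
    (push i u).length + (push i v).length + 2 * lcp u v =
      u.length + v.length + 2 * lcp (push i u) (push i v) := by
  have key : ∀ u v : List (ZMod 3), Reduced ((i + 1) :: u) → (∀ b ∈ v.head?, b ≠ i + 1) →
      lcp ((i + 1) :: u) v = 0 ∧ lcp (u.map (· + 1)) (i :: v) = 0 := by
    intro u v hu hv
    constructor
    · cases v with
      | nil => rfl
      | cons b v => simp [lcp, (hv b rfl).symm]
    · cases u with
      | nil => rfl
      | cons b u =>
        have := hu.head_ne b rfl
        have h2 : b + 1 ≠ i := by
          intro h; apply this; rw [← h]; generalize b = b; decide +revert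
        simp [lcp, h2]
  have dich : ∀ u : List (ZMod 3),
      (∀ b ∈ u.head?, b ≠ i + 1) ∨ ∃ u', u = (i + 1) :: u' := by
    intro u
    cases u with
    | nil => left; simp
    | cons b u =>
      by_cases hb : b = i + 1
      · exact Or.inr ⟨u, by rw [hb]⟩
      · left; simpa using hb
  rcases dich u with h | ⟨u, rfl⟩ <;> rcases dich v with h' | ⟨v, rfl⟩
  · rw [push_of_head h, push_of_head h']; simp [lcp]; omega
  · obtain ⟨h1, h2⟩ := key v u hv h
    rw [push_cons_succ, push_of_head h, lcp_comm, h1, lcp_comm (i :: u), h2]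
    simp; omega
  · obtain ⟨h1, h2⟩ := key u v hu h'
    rw [push_cons_succ, push_of_head h', h1, h2]
    simp; omega
  · rw [push_cons_succ, push_cons_succ, lcp_map]; simp [lcp]; omega

/-- `B3` acts by isometries of the tree of reduced words. -/
theorem lcp_act (g : B3) (u v : RedWord) :
    (act g u).1.length + (act g v).1.length + 2 * lcp u.1 v.1 =
      u.1.length + v.1.length + 2 * lcp (act g u).1 (act g v).1 := by
  induction g using induction_left generalizing u v with
  | one => simp
  | mul i g ih =>
    have h1 := ih u v
    have h2 := lcp_push (i := i) (act g u).2 (act g v).2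
    simp only [map_mul, Equiv.Perm.mul_apply, act_atom]
    omega
  | inv_mul i g ih =>
    have h1 := ih u v
    have h2 := lcp_push (i := i) (act ((atom i)⁻¹ * g) u).2 (act ((atom i)⁻¹ * g) v).2
    have h3 : ∀ u, push i (act ((atom i)⁻¹ * g) u).1 = (act g u).1 := by
      intro u
      rw [← act_atom, ← Equiv.Perm.mul_apply, ← map_mul, mul_inv_cancel_left]
    rw [h3, h3] at h2
    omega

/-- The base vertex of the tree. -/
def base : RedWord := ⟨[], List.isChain_nil⟩

/-- The vertex of the tree of reduced words to which `g` takes the base vertex. -/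
def vertex (g : B3) : List (ZMod 3) := (act g base).1

/-- The distance by which `g` moves the base vertex. -/
def len (g : B3) : ℕ := (vertex g).length

/-- Apply the isometry `g` to the vertices of `g⁻¹` and `h`: the first goes to the root. The common
prefix is what cancels in the product. -/
theorem len_mul (g h : B3) : len (g * h) + 2 * lcp (vertex g⁻¹) (vertex h) = len g + len h ∧
    len g⁻¹ = len g := by
  have h1 := lcp_act g base (act g⁻¹ base)
  have h2 := lcp_act g (act g⁻¹ base) (act h base)
  rw [← Equiv.Perm.mul_apply, ← map_mul, mul_inv_cancel, map_one, Equiv.Perm.one_apply] at h1 h2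
  rw [← Equiv.Perm.mul_apply, ← map_mul] at h2
  have h3 : base.1 = [] := rfl
  simp only [h3, lcp, lcp_nil_right, List.length_nil] at h1 h2
  simp only [len, vertex]
  omega

theorem len_inv (g : B3) : len g⁻¹ = len g := (len_mul g 1).2

theorem len_mul_le (g h : B3) : len (g * h) ≤ len g + len h := by
  have := (len_mul g h).1; omega

/-- The path from the root to the vertex of `g` splits into the part that survives in `g * h` and
the part that cancels. -/
theorem lcp_mul (g h : B3) :
    lcp (vertex (g * h)) (vertex g) + lcp (vertex g⁻¹) (vertex h) = len g := by
  have h1 := (len_mul g h).1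
  have h2 := lcp_act g (act h base) base
  rw [← Equiv.Perm.mul_apply, ← map_mul] at h2
  have h3 : base.1 = [] := rfl
  simp only [h3, lcp_nil_right, List.length_nil] at h2
  simp only [len, vertex] at *
  omega

theorem len_atom (i : ZMod 3) : len (atom i) = 1 := by
  rw [len, vertex, act_atom]; rfl

theorem len_delta : len delta = 0 := by
  rw [len, vertex, act_delta]; rfl

theorem len_word_le (α : List (ZMod 3)) : len (word α) ≤ α.length := by
  induction α with
  | nil => rw [word_nil, len, vertex, map_one]; rfl
  | cons i α ih =>
    have := len_mul_le (atom i) (word α)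
    rw [len_atom] at this
    rw [word_cons, List.length_cons]
    omega

/-! ### Hurwitz moves on lists -/

section ListMoves

variable {G : Type*} [Group G]

/-- One Hurwitz move, on lists. -/
inductive HurwitzStep : List G → List G → Prop
  | head (a b : G) (L : List G) : HurwitzStep (a :: b :: L) (a * b * a⁻¹ :: a :: L)
  | cons (a : G) {L L' : List G} : HurwitzStep L L' → HurwitzStep (a :: L) (a :: L')

/-- Hurwitz equivalence of lists. -/
def HurwitzRel : List G → List G → Prop := Relation.EqvGen HurwitzStep

namespace HurwitzRel

theorem refl (L : List G) : HurwitzRel L L := Relation.EqvGen.refl L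

theorem symm {L M : List G} (h : HurwitzRel L M) : HurwitzRel M L := Relation.EqvGen.symm _ _ h

theorem trans {L M N : List G} (h : HurwitzRel L M) (h' : HurwitzRel M N) : HurwitzRel L N :=
  Relation.EqvGen.trans _ _ _ h h'

theorem cons (a : G) {L M : List G} (h : HurwitzRel L M) : HurwitzRel (a :: L) (a :: M) := by
  induction h with
  | rel _ _ h => exact Relation.EqvGen.rel _ _ (h.cons a)
  | refl => exact refl _
  | symm _ _ _ ih => exact ih.symm
  | trans _ _ _ _ _ ih ih' => exact ih.trans ih'

theorem append_left (P : List G) {L M : List G} (h : HurwitzRel L M) :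
    HurwitzRel (P ++ L) (P ++ M) := by
  induction P with
  | nil => exact h
  | cons a P ih => exact ih.cons a

theorem swap (a b : G) (L : List G) : HurwitzRel (a :: b :: L) (a * b * a⁻¹ :: a :: L) :=
  Relation.EqvGen.rel _ _ (.head a b L)

theorem swap' (a b : G) (L : List G) : HurwitzRel (a :: b :: L) (b :: b⁻¹ * a * b :: L) := by
  have := (swap b (b⁻¹ * a * b) L).symm
  rwa [show b * (b⁻¹ * a * b) * b⁻¹ = a by group] at this

theorem length_eq {L M : List G} (h : HurwitzRel L M) : L.length = M.length := by
  induction h with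
  | rel _ _ h => induction h with
    | head => rfl
    | cons _ _ ih => simp [ih]
  | refl => rfl
  | symm _ _ _ ih => exact ih.symm
  | trans _ _ _ _ _ ih ih' => exact ih.trans ih'

theorem prod_eq {L M : List G} (h : HurwitzRel L M) : L.prod = M.prod := by
  induction h with
  | rel _ _ h => induction h with
    | head => simp [mul_assoc]
    | cons _ _ ih => simp [ih]
  | refl => rfl
  | symm _ _ _ ih => exact ih.symm
  | trans _ _ _ _ _ ih ih' => exact ih.trans ih'

theorem forall_isConj_iff (c : G) {L M : List G} (h : HurwitzRel L M) :
    (∀ g ∈ L, IsConj c g) ↔ ∀ g ∈ M, IsConj c g := by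
  induction h with
  | rel _ _ h => induction h with
    | head a b L =>
      have : IsConj c (a * b * a⁻¹) ↔ IsConj c b := by
        have : IsConj b (a * b * a⁻¹) := isConj_iff.2 ⟨a, rfl⟩
        exact ⟨fun h => h.trans this.symm, fun h => h.trans this⟩
      simp only [List.forall_mem_cons, this]
      tauto
    | cons _ _ ih => simp only [List.forall_mem_cons, ih]
  | refl => rfl
  | symm _ _ _ ih => exact ih.symm
  | trans _ _ _ _ _ ih ih' => exact ih.trans ih'

end HurwitzRel

theorem exists_hurwitzMove_of_step {L M : List G} (h : HurwitzStep L M) :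
    ∃ (k : ℕ) (x : Fin k → G) (i : Fin (k - 1)),
      List.ofFn x = L ∧ List.ofFn (hurwitzMove i x) = M := by
  induction h with
  | head a b L =>
    refine ⟨(a :: b :: L).length, (a :: b :: L).get, ⟨0, by simp⟩, List.ofFn_get _, ?_⟩
    apply List.ext_getElem
    · simp
    · intro n h1 h2
      rw [List.getElem_ofFn, hurwitzMove_apply]
      match n with
      | 0 => simp
      | 1 => simp
      | n + 2 => simp
  | @cons a L M h ih =>
    obtain ⟨k, x, i, rfl, rfl⟩ := ih
    have hi := i.2
    refine ⟨k + 1, Fin.cons a x, ⟨i + 1, by omega⟩, by simp, ?_⟩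
    rw [← List.ofFn_cons]
    congr 1
    funext ⟨j, hj⟩
    cases j with
    | zero => simp [hurwitzMove_apply]
    | succ j =>
      have e : ∀ (m : ℕ) (h : m + 1 < k + 1), (Fin.cons a x : Fin (k + 1) → G) ⟨m + 1, h⟩ =
        x ⟨m, by omega⟩ := fun m h => rfl
      change _ = hurwitzMove i x ⟨j, by omega⟩
      rw [hurwitzMove_apply, hurwitzMove_apply]
      simp only [e, add_left_inj]

theorem HurwitzRel.exists_braid {L M : List G} (h : HurwitzRel L M) :
    ∃ (k : ℕ) (x y : Fin k → G), List.ofFn x = L ∧ List.ofFn y = M ∧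
      ∃ b, hurwitzAction G k b x = y := by
  induction h with
  | rel L M h =>
    obtain ⟨k, x, i, h1, h2⟩ := exists_hurwitzMove_of_step h
    exact ⟨k, x, _, h1, h2, PresentedGroup.of i, by
      rw [hurwitzAction, PresentedGroup.toGroup.of]⟩
  | refl L => exact ⟨_, L.get, L.get, List.ofFn_get L, List.ofFn_get L, 1, by simp⟩
  | symm L M _ ih =>
    obtain ⟨k, x, y, h1, h2, b, rfl⟩ := ih
    exact ⟨k, _, x, h2, h1, b⁻¹, by
      rw [map_inv, Equiv.Perm.inv_eq_iff_eq]⟩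
  | trans L M N _ _ ih ih' =>
    obtain ⟨k, x, y, h1, h2, b, rfl⟩ := ih
    obtain ⟨k', x', y', h1', h2', b', rfl⟩ := ih'
    have hk : k = k' := by
      rw [← List.length_ofFn (f := x'), h1', ← h2, List.length_ofFn]
    subst hk
    obtain rfl := List.ofFn_injective (h1'.trans h2.symm)
    exact ⟨k, x, _, h1, h2', b' * b, by rw [map_mul, Equiv.Perm.mul_apply]⟩

theorem HurwitzRel.hurwitzEquivalent {k l : ℕ} {x : Fin k → G} {y : Fin l → G}
    (h : HurwitzRel (List.ofFn x) (List.ofFn y)) : HurwitzEquivalent x y := by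
  obtain ⟨m, x', y', h1, h2, b, hb⟩ := h.exists_braid
  have hk : m = k := by
    rw [← List.length_ofFn (f := x'), h1, List.length_ofFn]
  have hl : m = l := by
    rw [← List.length_ofFn (f := y'), h2, List.length_ofFn]
  subst hk hl
  obtain rfl := List.ofFn_injective h1
  obtain rfl := List.ofFn_injective h2
  exact ⟨rfl, b, hb⟩

end ListMoves

/-! ### Exponent sum -/

/-- The exponent sum. -/
def expSum : B3 →* Multiplicative ℤ :=
  PresentedGroup.toGroup (f := fun _ => Multiplicative.ofAdd 1) <| by
    rintro r rfl
    simp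

theorem expSum_sigma_one : expSum σ₁ = Multiplicative.ofAdd 1 := PresentedGroup.toGroup.of _

theorem expSum_sigma_two : expSum σ₂ = Multiplicative.ofAdd 1 := PresentedGroup.toGroup.of _

theorem expSum_prod {L : List B3} (h : ∀ g ∈ L, expSum g = Multiplicative.ofAdd 1) :
    expSum L.prod = Multiplicative.ofAdd (L.length : ℤ) := by
  induction L with
  | nil => simp
  | cons a L ih =>
    simp only [List.forall_mem_cons] at h
    rw [List.prod_cons, map_mul, h.1, ih h.2, ← ofAdd_add, List.length_cons]
    push_cast
    rw [add_comm]

theorem expSum_of_isConj {g : B3} (h : IsConj σ₁ g) : expSum g = Multiplicative.ofAdd 1 := by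
  obtain ⟨c, rfl⟩ := isConj_iff.1 h
  rw [map_mul, map_mul, map_inv, mul_inv_cancel_comm, expSum_sigma_one]

/-! ### Normal form of the conjugates of the generator -/

theorem len_conj_word_le (α : List (ZMod 3)) (j : ZMod 3) :
    len (word α * atom j * (word α)⁻¹) ≤ 2 * α.length + 1 := by
  have h1 := len_mul_le (word α * atom j) (word α)⁻¹
  have h2 := len_mul_le (word α) (atom j)
  have h3 := len_word_le α
  rw [len_inv] at h1
  rw [len_atom] at h2
  omega

theorem len_conj_delta (g : B3) : len (delta * g * delta⁻¹) = len g := by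
  have h1 := (len_mul delta g).1
  have h2 := (len_mul (delta * g) delta⁻¹).1
  have e0 : vertex delta⁻¹ = [] := by
    rw [← List.length_eq_zero_iff, ← len, len_inv, len_delta]
  rw [e0, lcp_nil_right, len_inv, len_delta] at h2
  rw [e0, lcp, len_delta] at h1
  omega

theorem conj_delta_word (α : List (ZMod 3)) (j : ZMod 3) :
    delta * (word α * atom j * (word α)⁻¹) * delta⁻¹ =
      word (α.map (· + 1)) * atom (j + 1) * (word (α.map (· + 1)))⁻¹ := by
  have h1 : word (α.map (· + 1)) = delta * word α * delta⁻¹ := by rw [delta_mul_word]; group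
  have h2 : atom (j + 1) = delta * atom j * delta⁻¹ := by rw [delta_mul_atom]; group
  rw [h1, h2]
  group

theorem delta_conj_succ (α : List (ZMod 3)) (j : ZMod 3) : ∃ β : List (ZMod 3), ∃ i,
    β.length = α.length ∧ delta⁻¹ * (word α * atom j * (word α)⁻¹) * delta =
      word β * atom i * (word β)⁻¹ := by
  refine ⟨α.map (· + 2), j + 2, by simp, ?_⟩
  have h := conj_delta_word (α.map (· + 2)) (j + 2)
  rw [map_map_add 2 1 rfl, add_two_add_one] at h
  rw [← h]
  group

/-- Inverse letters are not needed in the conjugator: `atom_inv` trades each for an atom and a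
`delta⁻¹`, which only shifts indices. -/
theorem exists_conj_word {g : B3} (h : IsConj σ₁ g) :
    ∃ α j, g = word α * atom j * (word α)⁻¹ := by
  obtain ⟨c, rfl⟩ := isConj_iff.1 h
  clear h
  induction c using induction_left with
  | one => exact ⟨[], 0, by simp [word_nil]; rfl⟩
  | mul i c ih =>
    obtain ⟨α, j, h⟩ := ih
    refine ⟨i :: α, j, ?_⟩
    rw [word_cons, show atom i * c * σ₁ * (atom i * c)⁻¹ = atom i * (c * σ₁ * c⁻¹) * (atom i)⁻¹ by
      group, h]
    group
  | inv_mul i c ih =>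
    obtain ⟨α, j, h⟩ := ih
    obtain ⟨β, k, -, hβ⟩ := delta_conj_succ α j
    refine ⟨(i + 1) :: β, k, ?_⟩
    rw [word_cons, atom_inv, show atom (i + 1) * delta⁻¹ * c * σ₁ * (atom (i + 1) * delta⁻¹ * c)⁻¹ =
      atom (i + 1) * (delta⁻¹ * (c * σ₁ * c⁻¹) * delta) * (atom (i + 1))⁻¹ by group, h, hβ]
    group

theorem act_word_append {α w : List (ZMod 3)} (h : Reduced (α ++ w)) (hw : Reduced w) :
    (act (word α) ⟨w, hw⟩).1 = α ++ w := by
  induction α with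
  | nil => rw [word_nil, map_one]; rfl
  | cons i α ih =>
    rw [word_cons, map_mul, Equiv.Perm.mul_apply, act_atom, ih h.tail]
    exact push_of_head h.head_ne

theorem vertex_word_inv {α : List (ZMod 3)} {a : ZMod 3} (h : Reduced (α ++ [a])) :
    ∃ t, vertex (word (α ++ [a]))⁻¹ = (a + 1) :: t := by
  induction α using List.reverseRecOn generalizing a with
  | nil =>
    refine ⟨[], ?_⟩
    rw [vertex, List.nil_append, word_cons, word_nil, mul_one, act_atom_inv]
    · rfl
    · simp [base]
  | append_singleton α b ih =>
    have hb : a ≠ b + 1 := by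
      have := (List.isChain_append.1 h).2.2
      exact this b (by simp) a (by simp)
    obtain ⟨t, ht⟩ := ih (List.IsChain.left_of_append h)
    rw [word_append, mul_inv_rev, vertex, map_mul, Equiv.Perm.mul_apply, word_cons, word_nil,
      mul_one, act_atom_inv]
    · exact ⟨_, rfl⟩
    · change ∀ c ∈ (vertex _).head?, _
      rw [ht]
      simpa using hb.symm

/-- Normal form of a conjugate of `σ₁`. -/
theorem exists_normal_form {g : B3} (h : IsConj σ₁ g) :
    ∃ α j, g = word α * atom j * (word α)⁻¹ ∧ len g = 2 * α.length + 1 ∧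
      (∃ s, vertex g = α ++ j :: s) ∧ (∃ t, vertex g⁻¹ = α ++ (j + 1) :: t) := by
  classical
  have hex : ∃ n, ∃ α j, α.length = n ∧ g = word α * atom j * (word α)⁻¹ := by
    obtain ⟨α, j, h⟩ := exists_conj_word h
    exact ⟨_, α, j, rfl, h⟩
  -- A shortest conjugating word is chosen; each cancellation excluded below would give a shorter
  -- one.
  obtain ⟨α, j, hα, hg⟩ := Nat.find_spec hex
  have hmin : ∀ β i, g = word β * atom i * (word β)⁻¹ → α.length ≤ β.length := by
    intro β i hβ
    rw [hα]
    exact Nat.find_min' hex ⟨β, i, rfl, hβ⟩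
  clear hα
  have hred : Reduced α := by
    rw [Reduced, List.isChain_iff_forall_rel_of_append_cons_cons]
    rintro a b β γ rfl rfl
    have h1 := hmin (β ++ γ.map (· + 1)) (j + 1) <| by
      have h1 : word (γ.map (· + 1)) = delta * word γ * delta⁻¹ := by rw [delta_mul_word]; group
      have h2 : atom (j + 1) = delta * atom j * delta⁻¹ := by rw [delta_mul_atom]; group
      rw [hg, word_append, word_append, word_cons, word_cons, h1, h2, ← mul_assoc (atom a),
        atom_mul_atom]
      group
    simp at h1
  -- If `j = a`, the last letter commutes with the core; if `j = a + 1`, conjugating the core by it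
  -- gives `atom (a + 2)`. In both cases the letter can be dropped.
  have hlast : ∀ a ∈ α.getLast?, j ≠ a ∧ j ≠ a + 1 := by
    rcases List.eq_nil_or_concat' α with rfl | ⟨β, a, rfl⟩
    · simp
    · simp only [List.getLast?_append, List.getLast?_singleton, Option.some_or, Option.mem_def,
        Option.some.injEq, forall_eq']
      constructor
      · rintro rfl
        have h1 := hmin β j <| by
          rw [hg, word_append, word_cons, word_nil]
          group
        simp at h1
      · rintro rfl
        have h1 := hmin β (a + 2) <| by
          have h1 : atom (a + 2) = delta * (atom a)⁻¹ := by
            have := atom_mul_atom (a + 2)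
            rw [add_two_add_one] at this
            rw [← this]
            group
          rw [hg, word_append, word_cons, word_nil, h1, ← atom_mul_atom a]
          group
        simp at h1
  -- The vertex of the inverse conjugator starts with `a + 1`, where `a` is the last letter of `α`,
  -- so `hlast` rules out cancellation with the core.
  have hs : ∀ b ∈ (vertex (word α)⁻¹).head?, b ≠ j ∧ b ≠ j + 1 := by
    rcases List.eq_nil_or_concat' α with rfl | ⟨β, a, rfl⟩
    · simp [word_nil, vertex, base]
    · obtain ⟨t, ht⟩ := vertex_word_inv hred
      rw [ht]
      simp only [List.getLast?_append, List.getLast?_singleton, Option.some_or, Option.mem_def,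
        Option.some.injEq, forall_eq', List.head?_cons] at hlast ⊢
      exact ⟨hlast.2.symm, fun h => hlast.1 (add_right_cancel h).symm⟩
  have happ : ∀ i w, (i = j ∨ i = j + 1) → Reduced (i :: w) → Reduced (α ++ i :: w) := by
    intro i w hi hw
    refine List.IsChain.append hred hw fun a ha b hb => ?_
    simp only [List.head?_cons, Option.mem_def, Option.some.injEq] at hb
    subst hb
    rcases hi with rfl | rfl
    · exact (hlast a ha).2
    · exact fun h => (hlast a ha).1 (add_right_cancel h)
  have h1 : vertex g = α ++ j :: vertex (word α)⁻¹ := by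
    have e : (act (atom j) (act (word α)⁻¹ base)).1 = j :: vertex (word α)⁻¹ := by
      rw [act_atom]
      exact push_of_head fun b hb => (hs b hb).2
    have hr := e ▸ (act (atom j) (act (word α)⁻¹ base)).2
    rw [← act_word_append (happ j _ (.inl rfl) hr) hr, hg, vertex, map_mul, map_mul,
      Equiv.Perm.mul_apply, Equiv.Perm.mul_apply]
    congr 2
    exact Subtype.ext e
  have h2 : ∃ t, vertex g⁻¹ = α ++ (j + 1) :: t := by
    have e : (act (atom j)⁻¹ (act (word α)⁻¹ base)).1 =
        (j + 1) :: (vertex (word α)⁻¹).map (· + 2) :=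
      act_atom_inv fun b hb => (hs b hb).1
    have hr := e ▸ (act (atom j)⁻¹ (act (word α)⁻¹ base)).2
    refine ⟨(vertex (word α)⁻¹).map (· + 2), ?_⟩
    rw [← act_word_append (happ _ _ (.inr rfl) hr) hr, vertex,
      show g⁻¹ = word α * ((atom j)⁻¹ * (word α)⁻¹) by rw [hg]; group, map_mul, map_mul, Equiv.Perm.mul_apply, Equiv.Perm.mul_apply]
    congr 2
    exact Subtype.ext e
  have h3 : len (word α) = α.length := by
    have h0 : Reduced (α ++ []) := by rwa [List.append_nil]
    have := act_word_append h0 List.isChain_nil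
    rw [len, vertex, base, this, List.append_nil]
  refine ⟨α, j, hg, ?_, ⟨_, h1⟩, h2⟩
  have h4 : (vertex (word α)⁻¹).length = α.length := by rw [← h3, ← len_inv, len]
  rw [len, h1, List.length_append, List.length_cons, h4]
  omega

/-! ### Cancellation between neighbouring factors -/

/-- Two consecutive factors between which less than half of each factor cancels. -/
def Separated (g h : B3) : Prop :=
  2 * lcp (vertex g⁻¹) (vertex h) < len g ∧ 2 * lcp (vertex g⁻¹) (vertex h) < len h

theorem exists_append_of_prefix {α β s t : List (ZMod 3)} {i : ZMod 3}
    (h : α.length + 1 ≤ lcp (α ++ i :: s) (β ++ t)) (hl : α.length < β.length) :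
    ∃ γ, β = α ++ i :: γ := by
  have h1 := (prefix_of_le_lcp h).1
  have h2 : (α ++ i :: s).take (α.length + 1) = α ++ [i] := by simp [List.take_append]
  rw [h2, List.take_append_of_le_length (by omega)] at h1
  refine ⟨β.drop (α.length + 1), ?_⟩
  conv_lhs => rw [← List.take_append_drop (α.length + 1) β, ← h1]
  simp

/-- By the normal forms, the common prefix extends one letter past the shorter conjugator. If the
conjugators differ in length, that letter lies in the longer one, and the Hurwitz move removes it.
If they have equal length, they coincide and the cores are `i`, `i + 1`; a last letter `a` of the
conjugator would make `g` or `h` shorter than its normal form. -/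
theorem reduce_pair {g h : B3} (hg : IsConj σ₁ g) (hh : IsConj σ₁ h) (hgh : ¬ Separated g h) :
    len (g * h * g⁻¹) < len h ∨ len (h⁻¹ * g * h) < len g ∨ ∃ i, g = atom i ∧ h = atom (i + 1) := by
  obtain ⟨α, i, hα, hlα, ⟨s, hs⟩, ⟨t, ht⟩⟩ := exists_normal_form hg
  obtain ⟨β, j, hβ, hlβ, ⟨u, hu⟩, -⟩ := exists_normal_form hh
  rw [Separated, not_and_or, ht, hu, hlα, hlβ] at hgh
  rcases lt_trichotomy α.length β.length with hlt | heq | hlt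
  · left
    obtain ⟨γ, rfl⟩ := exists_append_of_prefix (i := i + 1) (s := t) (t := j :: u) (by omega) hlt
    have e : g * h * g⁻¹ = word (α ++ γ.map (· + 1)) * atom (j + 1) *
        (word (α ++ γ.map (· + 1)))⁻¹ := by
      have h1 := conj_delta_word γ j
      have h2 : ∀ v : B3, word (α ++ γ.map (· + 1)) * v * (word (α ++ γ.map (· + 1)))⁻¹ =
          word α * (word (γ.map (· + 1)) * v * (word (γ.map (· + 1)))⁻¹) * (word α)⁻¹ := by
        intro v; rw [word_append]; group
      rw [h2, ← h1, hα, hβ, word_append, word_cons, ← atom_mul_atom i]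
      group
    rw [e, hlβ]
    have := len_conj_word_le (α ++ γ.map (· + 1)) (j + 1)
    simp at this ⊢
    omega
  · right; right
    have h1 : α.length + 1 ≤ lcp (α ++ (i + 1) :: t) (β ++ j :: u) := by omega
    have h2 := (prefix_of_le_lcp h1).1
    have h3 : (α ++ (i + 1) :: t).take (α.length + 1) = α ++ [i + 1] := by
      simp [List.take_append]
    have h4 : (β ++ j :: u).take (β.length + 1) = β ++ [j] := by simp [List.take_append]
    rw [h3, heq, h4] at h2
    obtain ⟨rfl, h5⟩ := List.append_inj h2 heq
    obtain rfl : i + 1 = j := by simpa using h5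
    rcases List.eq_nil_or_concat' α with rfl | ⟨γ, a, rfl⟩
    · exact ⟨i, by rw [hα, word_nil]; group, by rw [hβ, word_nil]; group⟩
    · exfalso
      have hw : word (γ ++ [a]) = word γ * atom a := by
        rw [word_append, word_cons, word_nil, mul_one]
      have same : ∀ f : B3, f = word (γ ++ [a]) * atom a * (word (γ ++ [a]))⁻¹ →
          len f = 2 * (γ ++ [a]).length + 1 → False := by
        intro f hf hl
        have e : f = word γ * atom a * (word γ)⁻¹ := by rw [hf, hw]; group
        have := len_conj_word_le γ a
        rw [← e, hl] at this
        simp at this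
      obtain rfl | rfl | h6 : i = a ∨ i = a + 1 ∨ i + 1 = a := by clear * -; decide +revert
      · exact same g hα hlα
      · have e : g = word γ * atom (a + 2) * (word γ)⁻¹ := by
          have h1 := atom_mul_atom (a + 2)
          rw [add_two_add_one, ← atom_mul_atom a] at h1
          rw [hα, hw, show word γ * atom a * atom (a + 1) * (word γ * atom a)⁻¹ =
            word γ * (atom a * atom (a + 1)) * (word γ * atom a)⁻¹ by group, ← h1]
          group
        have := len_conj_word_le γ (a + 2)
        rw [← e, hlα] at this
        simp at this
      · rw [h6] at hβ
        exact same h hβ hlβ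
  · right; left
    rw [lcp_comm] at hgh
    obtain ⟨γ, rfl⟩ := exists_append_of_prefix (i := j) (s := u) (t := (i + 1) :: t) (by omega) hlt
    have e : h⁻¹ * g * h = word (β ++ γ) * atom i * (word (β ++ γ))⁻¹ := by
      rw [hα, hβ, word_append, word_append, word_cons]
      group
    rw [e, hlα]
    have := len_conj_word_le (β ++ γ) i
    simp at this ⊢
    omega

/-- The induction needs the first conclusion: more than half of the first factor survives in the
product. By the ultrametric inequality, a factor put in front then cancels against the whole product
exactly as against its first factor, and each such step adds at least one to the length. -/
theorem separated_chain {g : B3} {L : List B3} (hc : (g :: L).IsChain Separated)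
    (hpos : ∀ h ∈ g :: L, 0 < len h) :
    len g < 2 * lcp (vertex (g :: L).prod) (vertex g) ∧ L.length + len g ≤ len (g :: L).prod ∧
      (len (g :: L).prod ≤ L.length + 1 → ∀ h ∈ g :: L, len h = 1) := by
  induction L generalizing g with
  | nil =>
    have := hpos g (by simp)
    have h1 : (vertex g).length = len g := rfl
    simp only [List.prod_cons, List.prod_nil, mul_one, lcp_self, h1, List.length_nil,
      List.mem_singleton, forall_eq]
    omega
  | cons h L ih =>
    obtain ⟨⟨hs1, hs2⟩, hc⟩ := List.isChain_cons_cons.1 hc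
    obtain ⟨h1, h2, h3⟩ := ih hc fun x hx => hpos x (List.mem_cons_of_mem _ hx)
    rw [List.prod_cons (a := g)]
    set w := (h :: L).prod
    have h4 := (len_mul g w).1
    have h5 := lcp_mul g w
    have h6 := lcp_ultrametric (vertex g⁻¹) (vertex h) (vertex w)
    have h7 := lcp_ultrametric (vertex g⁻¹) (vertex w) (vertex h)
    rw [lcp_comm (vertex h)] at h6
    rw [List.length_cons]
    refine ⟨by omega, by omega, fun h8 => List.forall_mem_cons.2 ⟨by omega, h3 (by omega)⟩⟩

theorem exists_not_of_not_isChain {α : Type*} {R : α → α → Prop} {L : List α}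
    (h : ¬ L.IsChain R) : ∃ L₁ a b L₂, L = L₁ ++ a :: b :: L₂ ∧ ¬ R a b := by
  rw [List.isChain_iff_forall_rel_of_append_cons_cons] at h
  push Not at h
  obtain ⟨a, b, L₁, L₂, h1, h2⟩ := h
  exact ⟨L₁, a, b, L₂, h1, h2⟩

theorem exists_atom_of_len_eq_one {g : B3} (hg : IsConj σ₁ g) (h : len g = 1) :
    ∃ i, g = atom i := by
  obtain ⟨α, i, hα, hl, -⟩ := exists_normal_form hg
  obtain rfl : α = [] := List.length_eq_zero_iff.1 (by omega)
  exact ⟨i, by rw [hα, word_nil]; group⟩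

theorem len_pos {g : B3} (hg : IsConj σ₁ g) : 0 < len g := by
  obtain ⟨α, i, -, hl, -⟩ := exists_normal_form hg
  omega

theorem exists_conj_atom_lt {g : B3} (hg : IsConj σ₁ g) (h : len g ≠ 1) :
    ∃ b, len (atom (b + 1) * g * (atom (b + 1))⁻¹) < len g := by
  obtain ⟨α, i, hα, hl, -⟩ := exists_normal_form hg
  cases α with
  | nil => exact absurd hl h
  | cons a α =>
    -- Then `atom (b + 1) * atom a = delta`, so the first letter `a` of the conjugator is absorbed.
    refine ⟨a + 1, ?_⟩
    have e : atom (a + 1 + 1) * g * (atom (a + 1 + 1))⁻¹ =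
        word (α.map (· + 1)) * atom (i + 1) * (word (α.map (· + 1)))⁻¹ := by
      have := atom_mul_atom (a + 1 + 1)
      rw [show a + 1 + 1 + 1 = a by rw [add_assoc a, one_add_one_eq_two, add_two_add_one]] at this
      rw [← conj_delta_word, hα, word_cons, ← this]
      group
    have := len_conj_word_le (α.map (· + 1)) (i + 1)
    rw [e, hl]
    simp at this ⊢
    omega

/-! ### Moving `delta` and descent to atoms -/

/-- One move turns the pair at `i` into the pair at `i + 2`, and `2` generates `ZMod 3`. -/
theorem hurwitzRel_delta (i j : ZMod 3) (L : List B3) :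
    HurwitzRel (atom i :: atom (i + 1) :: L) (atom j :: atom (j + 1) :: L) := by
  have key : ∀ i, HurwitzRel (atom i :: atom (i + 1) :: L) (atom (i + 2) :: atom (i + 2 + 1) :: L) := by
    intro i
    have h1 := HurwitzRel.swap (atom i) (atom (i + 1)) L
    have h2 := atom_mul_atom (i + 2)
    rw [add_two_add_one] at h2 ⊢
    rwa [atom_mul_atom, ← h2, mul_inv_cancel_right] at h1
  have h1 := key i
  have h2 := h1.trans (key (i + 2))
  have h3 := h2.trans (key (i + 2 + 2))
  obtain h | h | h : j = i + 2 ∨ j = i + 2 + 2 ∨ j = i + 2 + 2 + 2 := by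
    clear * -; decide +revert
  all_goals rw [h]; assumption

theorem hurwitzRel_delta_cons (i : ZMod 3) (a : B3) (L : List B3) :
    HurwitzRel (atom i :: atom (i + 1) :: a :: L)
      (delta * a * delta⁻¹ :: atom i :: atom (i + 1) :: L) := by
  have h1 := (HurwitzRel.swap (atom (i + 1)) a L).cons (atom i)
  have h2 := HurwitzRel.swap (atom i) (atom (i + 1) * a * (atom (i + 1))⁻¹) (atom (i + 1) :: L)
  have h3 : delta * a * delta⁻¹ =
      atom i * (atom (i + 1) * a * (atom (i + 1))⁻¹) * (atom i)⁻¹ := by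
    rw [← atom_mul_atom i]; group
  rw [h3]
  exact h1.trans h2

theorem hurwitzRel_cons_delta (i : ZMod 3) (a : B3) (L : List B3) :
    HurwitzRel (a :: atom i :: atom (i + 1) :: L)
      (atom i :: atom (i + 1) :: delta⁻¹ * a * delta :: L) := by
  have h := (hurwitzRel_delta_cons i (delta⁻¹ * a * delta) L).symm
  rwa [show delta * (delta⁻¹ * a * delta) * delta⁻¹ = a by group] at h

theorem hurwitzRel_append_delta (i : ZMod 3) (L M : List B3) :
    HurwitzRel (L ++ atom i :: atom (i + 1) :: M)
      (atom i :: atom (i + 1) :: (L.map (fun a => delta⁻¹ * a * delta) ++ M)) := by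
  induction L with
  | nil => exact HurwitzRel.refl _
  | cons a L ih => exact (ih.cons a).trans (hurwitzRel_cons_delta i a _)

/-- The total length of a tuple. -/
def size (L : List B3) : ℕ := (L.map len).sum

theorem size_cons (a : B3) (L : List B3) : size (a :: L) = len a + size L := by simp [size]

theorem size_append (L M : List B3) : size (L ++ M) = size L + size M := by simp [size]

theorem len_conj_delta_inv (g : B3) : len (delta⁻¹ * g * delta) = len g := by
  rw [← len_conj_delta (delta⁻¹ * g * delta)]
  congr 1
  group

/-- The pair travels right past the atoms, changing no length, up to the first longer factor. There
it is rewritten so that its second atom shortens this factor by conjugation. -/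
theorem reduce_delta {M : List B3} (i : ZMod 3) (hM : ∀ g ∈ M, IsConj σ₁ g)
    (h : ∃ g ∈ M, len g ≠ 1) :
    ∃ N, HurwitzRel (atom i :: atom (i + 1) :: M) N ∧ size N < size M + 2 := by
  induction M with
  | nil => simp at h
  | cons v M ih =>
    simp only [List.forall_mem_cons] at hM
    by_cases hv : len v = 1
    · obtain ⟨N, hN, hlt⟩ := ih hM.2 (by simpa [hv] using h)
      refine ⟨_, (hurwitzRel_delta_cons i v M).trans (hN.cons _), ?_⟩
      rw [size_cons, size_cons, len_conj_delta]
      omega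
    · obtain ⟨b, hb⟩ := exists_conj_atom_lt hM.1 hv
      refine ⟨_, (hurwitzRel_delta i b _).trans ((HurwitzRel.swap _ v M).cons _), ?_⟩
      simp only [size_cons, len_atom]
      omega

theorem exists_hurwitzRel_atoms (L : List B3) (hL : ∀ g ∈ L, IsConj σ₁ g)
    (hlen : len L.prod ≤ L.length) : ∃ A : List (ZMod 3), HurwitzRel L (A.map atom) := by
  induction hn : size L using Nat.strong_induction_on generalizing L with
  | _ n ih =>
  subst hn
  have descend : ∀ M, HurwitzRel L M → size M < size L →
      ∃ A : List (ZMod 3), HurwitzRel L (A.map atom) := by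
    intro M hM hlt
    obtain ⟨A, hA⟩ := ih _ hlt M ((hM.forall_isConj_iff σ₁).1 hL)
      (by rw [← hM.prod_eq, ← hM.length_eq]; exact hlen) rfl
    exact ⟨A, hM.trans hA⟩
  by_cases hone : ∀ g ∈ L, len g = 1
  · clear ih descend hlen
    induction L with
    | nil => exact ⟨[], HurwitzRel.refl _⟩
    | cons g L ih =>
      simp only [List.forall_mem_cons] at hL hone
      obtain ⟨A, hA⟩ := ih hL.2 hone.2
      obtain ⟨i, rfl⟩ := exists_atom_of_len_eq_one hL.1 hone.1
      exact ⟨i :: A, hA.cons _⟩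
  by_cases hc : L.IsChain Separated
  · cases L with
    | nil => simp at hone
    | cons g L =>
      exact absurd ((separated_chain hc fun h hh => len_pos (hL h hh)).2.2 hlen) hone
  obtain ⟨P, g, h, Q, rfl, hgh⟩ := exists_not_of_not_isChain hc
  rcases reduce_pair (hL g (by simp)) (hL h (by simp)) hgh with hlt | hlt | ⟨i, rfl, rfl⟩
  · refine descend _ ((HurwitzRel.swap g h Q).append_left P) ?_
    simp only [size_append, size_cons]
    omega
  · refine descend _ ((HurwitzRel.swap' g h Q).append_left P) ?_
    simp only [size_append, size_cons]
    omega
  -- The pair is first carried to the front; the factors it passes are conjugated by `delta⁻¹` and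
  -- keep their lengths.
  · have h1 := hurwitzRel_append_delta i P Q
    obtain ⟨N, hN, hlt⟩ := reduce_delta i (M := P.map (fun a => delta⁻¹ * a * delta) ++ Q)
      (fun g hg => (h1.forall_isConj_iff σ₁).1 hL g (by simp only [List.mem_cons]; tauto)) <| by
        push Not at hone
        obtain ⟨g, hg, hg1⟩ := hone
        rcases List.mem_append.1 hg with hg | hg
        · exact ⟨delta⁻¹ * g * delta,
            List.mem_append_left _ (List.mem_map_of_mem hg), by rwa [len_conj_delta_inv]⟩
        · simp only [List.mem_cons] at hg
          rcases hg with rfl | rfl | hg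
          · exact absurd (len_atom _) hg1
          · exact absurd (len_atom _) hg1
          · exact ⟨g, List.mem_append_right _ hg, hg1⟩
    refine descend N (h1.trans hN) ?_
    have h2 : size (P.map (fun a => delta⁻¹ * a * delta)) = size P := by
      simp only [size, List.map_map]
      congr 2
      funext a
      exact len_conj_delta_inv a
    rw [size_append, h2] at hlt
    simp only [size_append, size_cons, len_atom]
    omega

/-! ### Uniqueness for factorizations into atoms -/

/-- The list `(σ₁, σ₂, …, σ₁, σ₂)` of length `2 p`. -/
def deltas : ℕ → List B3
  | 0 => []
  | p + 1 => atom 0 :: atom (0 + 1) :: deltas p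

theorem length_deltas (p : ℕ) : (deltas p).length = 2 * p := by
  induction p with
  | zero => rfl
  | succ p ih => simp [deltas, ih]; ring

theorem hurwitzRel_cons_deltas (p : ℕ) (i : ZMod 3) (L : List B3) :
    ∃ j, HurwitzRel (atom i :: (deltas p ++ L)) (deltas p ++ atom j :: L) := by
  induction p generalizing i with
  | zero => exact ⟨i, HurwitzRel.refl _⟩
  | succ p ih =>
    obtain ⟨j, hj⟩ := ih (i + 2)
    refine ⟨j, (hurwitzRel_cons_delta 0 (atom i) _).trans ?_⟩
    have h := delta_mul_atom (i + 2)
    rw [add_two_add_one] at h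
    rw [show delta⁻¹ * atom i * delta = atom (i + 2) by rw [mul_assoc, ← h]; group]
    exact (hj.cons _).cons _

theorem exists_reduced_deltas (A : List (ZMod 3)) : ∃ p w, Reduced w ∧
    HurwitzRel (A.map atom) (deltas p ++ w.map atom) := by
  induction A with
  | nil => exact ⟨0, [], List.isChain_nil, HurwitzRel.refl _⟩
  | cons i A ih =>
    obtain ⟨p, w, hw, h⟩ := ih
    obtain ⟨j, hj⟩ := hurwitzRel_cons_deltas p i (w.map atom)
    have h1 := (h.cons (atom i)).trans hj
    by_cases hd : ∀ b ∈ w.head?, b ≠ j + 1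
    · exact ⟨p, j :: w, List.isChain_cons.2 ⟨hd, hw⟩, h1⟩
    · cases w with
      | nil => simp at hd
      | cons b w =>
        obtain rfl : b = j + 1 := by simpa using hd
        obtain ⟨q, hq⟩ : ∃ q, deltas p ++ atom 0 :: atom (0 + 1) :: w.map atom =
            deltas q ++ w.map atom := by
          refine ⟨p + 1, ?_⟩
          clear h hj h1
          induction p with
          | zero => rfl
          | succ p ih => simp only [deltas, List.cons_append] at ih ⊢; rw [ih]
        refine ⟨q, w, hw.tail, h1.trans ?_⟩
        rw [← hq]
        exact (hurwitzRel_delta j 0 _).append_left _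

theorem len_deltas_prod_mul (p : ℕ) (g : B3) : len ((deltas p).prod * g) = len g := by
  induction p with
  | zero => rw [deltas, List.prod_nil, one_mul]
  | succ p ih =>
    have e : (deltas (p + 1)).prod * g = delta * ((deltas p).prod * g) := by
      rw [deltas, List.prod_cons, List.prod_cons, ← atom_mul_atom 0]
      group
    rw [e, len, vertex, map_mul, Equiv.Perm.mul_apply, act_delta, List.length_map]
    exact ih

theorem vertex_word {w : List (ZMod 3)} (hw : Reduced w) : vertex (word w) = w := by
  have h0 : Reduced (w ++ []) := by rwa [List.append_nil]
  have := act_word_append h0 List.isChain_nil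
  rwa [List.append_nil] at this

/-- Powers of `delta` do not affect `len`, so both reduced remainders have the same length, and
hence both sides have the same number of `delta` pairs. After these are cancelled, the vertex of the
product recovers the reduced word. -/
theorem hurwitzRel_of_atoms {A B : List (ZMod 3)} (hl : A.length = B.length)
    (h : word A = word B) : HurwitzRel (A.map atom) (B.map atom) := by
  obtain ⟨p, w, hw, h1⟩ := exists_reduced_deltas A
  obtain ⟨q, u, hu, h2⟩ := exists_reduced_deltas B
  have hprod : (deltas p).prod * word w = (deltas q).prod * word u := by
    rw [word, word, ← List.prod_append, ← List.prod_append, ← h1.prod_eq, ← h2.prod_eq]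
    exact h
  have hlen : w.length = u.length := by
    have := congrArg len hprod
    rw [len_deltas_prod_mul, len_deltas_prod_mul] at this
    rwa [len, len, vertex_word hw, vertex_word hu] at this
  have l1 := h1.length_eq
  have l2 := h2.length_eq
  simp only [List.length_append, List.length_map, length_deltas] at l1 l2
  obtain rfl : p = q := by omega
  have hwu := congrArg vertex (mul_left_cancel hprod)
  rw [vertex_word hw, vertex_word hu] at hwu
  rw [hwu] at h1
  exact h1.trans h2.symm

/-! ### Factorizations of positive braids -/

theorem IsQuasipositiveFactorization.expSum_eq {X : B3} {k : ℕ} {x : Fin k → B3}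
    (hx : IsQuasipositiveFactorization X x) : expSum X = Multiplicative.ofAdd (k : ℤ) := by
  rw [← hx.1, expSum_prod, List.length_ofFn]
  intro g hg
  obtain ⟨i, rfl⟩ := (List.mem_ofFn' _ _).1 hg
  exact expSum_of_isConj (hx.2 i)

/-- This is the only use of positivity: the exponent sum counts the letters of a positive word, and
each letter moves the root by one. -/
theorem IsPositive.len_le {X : B3} (hX : IsPositive X) {k : ℕ}
    (hk : expSum X = Multiplicative.ofAdd (k : ℤ)) : len X ≤ k := by
  obtain ⟨w, hw, rfl⟩ := hX
  have h1 : ∃ α, w = List.map atom α := by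
    clear hk
    induction w with
    | nil => exact ⟨[], rfl⟩
    | cons a w ih =>
      simp only [List.forall_mem_cons] at hw
      obtain ⟨α, rfl⟩ := ih hw.2
      rcases hw.1 with rfl | rfl
      · exact ⟨0 :: α, rfl⟩
      · exact ⟨1 :: α, rfl⟩
  rw [expSum_prod] at hk
  · have : w.length = k := by exact_mod_cast Multiplicative.ofAdd.injective hk
    obtain ⟨α, rfl⟩ := h1
    rw [← this, List.length_map]
    exact len_word_le α
  · intro g hg
    rcases hw g hg with rfl | rfl
    exacts [expSum_sigma_one, expSum_sigma_two]

theorem IsQuasipositiveFactorization.exists_atoms {X : B3} (hX : IsPositive X) {k : ℕ}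
    {x : Fin k → B3} (hx : IsQuasipositiveFactorization X x) :
    ∃ A : List (ZMod 3), A.length = k ∧ word A = X ∧ HurwitzRel (List.ofFn x) (A.map atom) := by
  obtain ⟨A, hA⟩ := exists_hurwitzRel_atoms (List.ofFn x)
    (fun g hg => by obtain ⟨i, rfl⟩ := (List.mem_ofFn' _ _).1 hg; exact hx.2 i)
    (by rw [hx.1, List.length_ofFn]; exact hX.len_le hx.expSum_eq)
  refine ⟨A, ?_, ?_, hA⟩
  · have := hA.length_eq
    rw [List.length_ofFn, List.length_map] at this
    exact this.symm
  · rw [word, ← hA.prod_eq, hx.1]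

end HurwitzBraid

theorem corollary3 (X : HurwitzBraid.B3) (hX : HurwitzBraid.IsPositive X)
    {k l : ℕ} (x : Fin k → HurwitzBraid.B3) (y : Fin l → HurwitzBraid.B3)
    (hx : HurwitzBraid.IsQuasipositiveFactorization X x)
    (hy : HurwitzBraid.IsQuasipositiveFactorization X y) :
    HurwitzBraid.HurwitzEquivalent x y := by
  obtain ⟨A, hAk, hAX, hA⟩ := hx.exists_atoms hX
  obtain ⟨B, hBl, hBX, hB⟩ := hy.exists_atoms hX
  have hkl : k = l := by
    exact_mod_cast Multiplicative.ofAdd.injective (hx.expSum_eq.symm.trans hy.expSum_eq)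
  exact (hA.trans ((HurwitzBraid.hurwitzRel_of_atoms (by omega) (hAX.trans hBX.symm)).trans
    hB.symm)).hurwitzEquivalent
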